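/- Let $G$ be a hyperbolic group in the sense of Gromov: $G$ has a finite generating set $S$ (fixed, arbitrary) such that, for the word metric $d$ of the Cayley graph $\Gamma(G,S)$ and the Gromov product $(x|y)_w=\tfrac12\big(d(x,w)+d(y,w)-d(x,y)\big)$, there is $\delta$ with $(x|y)_w\ge\min\{(x|z)_w,(z|y)_w\}-\delta$ for all $w,x,y,z\in G$. (No assumption on torsion is made.) Let $\partial G$ be the Gromov boundary of $G$: the set of geodesic rays, i.e. isometric embeddings $\alpha:\mathbb N\to G$, where $\alpha,\beta$ are identified if $\sup_n d(\alpha(n),\beta(n))<\infty$. It carries the usual topology, in which the sets $$V(p,r)=\big\{[\beta] : \alpha,\beta \text{ rays with } \alpha(0)=\beta(0)=e,\ [\alpha]=p,\ \liminf_{t\to\infty}(\alpha(t)|\beta(t))_e\ge r\big\}$$ form a neighbourhood basis at $p$ (a set is open if and only if together with each of its points $p$ it contains some $V(p,r)$). For a finite alphabet $\Sigma$, a *cylinder* in $\Sigma^{\mathbb N}$ is a set $\pi_F^{-1}(B)$, where $F\subset\mathbb N$ is finite, $B\subseteq\Sigma^F$ and $\pi_F:\Sigma^{\mathbb N}\to\Sigma^F$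 is the projection. A set $M\subseteq\Sigma^{\mathbb N}$ is *semi-Markovian* if $M=C_1\cap\bigcap_{n\ge0}T^{-n}(C_2)$ for some cylinders $C_1,C_2$, where $T(a_0,a_1,\dots)=(a_1,a_2,\dots)$ is the shift. A relation $R\subseteq\Sigma^{\mathbb N}\times\Sigma^{\mathbb N}$ is *semi-Markovian* if it is a semi-Markovian set over the alphabet $\Sigma\times\Sigma$ under the identification $\big((a_n),(b_n)\big)\mapsto\big((a_n,b_n)\big)_n$. A Hausdorff topological space is a *semi-Markovian space* if it is homeomorphic to the topological quotient $M/{\sim}$ of a semi-Markovian set $M\subseteq\Sigma^{\mathbb N}$, for some finite alphabet $\Sigma$ (with the topology induced by the product topology on $\Sigma^{\mathbb N}$), by an equivalence relation $\sim$ on $M$ that is, as a set of pairs of words, semi-Markovian. **Theorem.** $\partial G$ is a semi-Markovian space. -/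

import Mathlib

open Filter Topology

section SemiMarkovian

/-- The shift `(a₀, a₁, …) ↦ (a₁, a₂, …)` on infinite words. -/
def wordShift {A : Type*} (a : ℕ → A) : ℕ → A := fun n => a (n + 1)

/-- A cylinder: the preimage, under the projection to a finite set `F` of positions, of a set of
`F`-indexed words. -/
def IsCylinder {A : Type*} (C : Set (ℕ → A)) : Prop :=
  ∃ (F : Finset ℕ) (B : Set (F → A)), C = MeasureTheory.cylinder F B

/-- A semi-Markovian set `C₁ ∩ ⋂ₙ S⁻ⁿ(C₂)`, with `C₁`, `C₂` cylinders and `S` the shift. -/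
def IsSemiMarkovianSet {A : Type*} (M : Set (ℕ → A)) : Prop :=
  ∃ C₁ C₂ : Set (ℕ → A), IsCylinder C₁ ∧ IsCylinder C₂ ∧
    M = C₁ ∩ ⋂ n : ℕ, wordShift^[n] ⁻¹' C₂

/-- The identification of pairs of words with words of pairs. -/
def zipWords {A : Type*} (p : (ℕ → A) × (ℕ → A)) : ℕ → A × A := fun n => (p.1 n, p.2 n)

/-- A semi-Markovian relation on words: its image over the product alphabet is a semi-Markovian
set. -/
def IsSemiMarkovianRelation {A : Type*} (R : Set ((ℕ → A) × (ℕ → A))) : Prop :=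
  IsSemiMarkovianSet (zipWords '' R)

/-- The graph, as a set of pairs of words, of an equivalence relation on a set `M` of words. -/
def relationGraph {A : Type*} {M : Set (ℕ → A)} (s : Setoid M) : Set ((ℕ → A) × (ℕ → A)) :=
  {p | ∃ (h₁ : p.1 ∈ M) (h₂ : p.2 ∈ M), s ⟨p.1, h₁⟩ ⟨p.2, h₂⟩}

/-- A semi-Markovian space: a Hausdorff space which is homeomorphic to the topological quotient
of a semi-Markovian set of words over a finite (discrete) alphabet, with the topology induced by
the product topology, by a semi-Markovian equivalence relation. -/
def IsSemiMarkovianSpace (Ω : Type*) [TopologicalSpace Ω] : Prop :=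
  T2Space Ω ∧
    ∃ (A : Type) (_ : Finite A) (_ : TopologicalSpace A) (_ : DiscreteTopology A)
      (M : Set (ℕ → A)) (s : Setoid M),
      IsSemiMarkovianSet M ∧ IsSemiMarkovianRelation (relationGraph s) ∧
        Nonempty (Quotient s ≃ₜ Ω)

end SemiMarkovian

section HyperbolicGroup

variable {G : Type*} [Group G]

/-- The word metric of `G` with respect to `S`: the path metric of the Cayley graph. -/
noncomputable def wordDist (S : Set G) (x y : G) : ℕ := (SimpleGraph.mulCayley S).dist x y

/-- The Gromov product `(x | y)_w` for the word metric. -/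
noncomputable def gromovProduct (S : Set G) (w x y : G) : ℝ :=
  ((wordDist S x w : ℝ) + (wordDist S y w : ℝ) - (wordDist S x y : ℝ)) / 2

/-- Gromov's four-point hyperbolicity condition for the word metric with respect to `S`. -/
def IsHyperbolicWith (S : Set G) : Prop :=
  ∃ δ : ℝ, ∀ w x y z : G,
    min (gromovProduct S w x z) (gromovProduct S w z y) - δ ≤ gromovProduct S w x y

/-- Geodesic rays: isometric embeddings of `ℕ` into `G`. -/
def GeodesicRay (S : Set G) : Type _ :=
  {α : ℕ → G // ∀ m n : ℕ, wordDist S (α m) (α (m + n)) = n}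

/-- Two rays are close if `d (α n) (β n)` is bounded. The distance is taken here with values in
`ℕ∞`; for a generating set it is never infinite and agrees with `wordDist`. -/
def rayClose (S : Set G) : Setoid (GeodesicRay S) where
  r α β := ∃ C : ℕ, ∀ n : ℕ, (SimpleGraph.mulCayley S).edist (α.1 n) (β.1 n) ≤ C
  iseqv :=
    { refl := fun α => ⟨0, fun n => by simp⟩
      symm := fun {α β} h => by
        obtain ⟨C, hC⟩ := h
        exact ⟨C, fun n => by rw [SimpleGraph.edist_comm]; exact hC n⟩
      trans := fun {α β γ} h h' => by
        obtain ⟨C, hC⟩ := h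
        obtain ⟨C', hC'⟩ := h'
        refine ⟨C + C', fun n => ?_⟩
        push_cast
        exact SimpleGraph.edist_triangle.trans (add_le_add (hC n) (hC' n)) }

/-- The Gromov boundary of `G` (with generating set `S`): geodesic rays up to closeness. -/
def GromovBoundary (S : Set G) : Type _ := Quotient (rayClose S)

/-- The point at infinity of a geodesic ray. -/
def rayEnd {S : Set G} (α : GeodesicRay S) : GromovBoundary S := Quotient.mk (rayClose S) α

/-- The basic neighbourhood `V(p, r)` of `p`: the points `q` for which there are rays `α`, `β`
starting at the identity, going to `p` and `q`, with `liminf (α t | β t)_1 ≥ r`. The lower limit is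
taken in the extended reals. -/
def boundaryNhd (S : Set G) (p : GromovBoundary S) (r : ℝ) : Set (GromovBoundary S) :=
  {q | ∃ α β : GeodesicRay S, α.1 0 = 1 ∧ β.1 0 = 1 ∧ rayEnd α = p ∧ rayEnd β = q ∧
    (r : EReal) ≤ liminf (fun t : ℕ => ((gromovProduct S 1 (α.1 t) (β.1 t) : ℝ) : EReal)) atTop}

theorem boundaryNhd_anti (S : Set G) (p : GromovBoundary S) {r r' : ℝ} (h : r ≤ r') :
    boundaryNhd S p r' ⊆ boundaryNhd S p r := by
  rintro q ⟨α, β, h1, h2, h3, h4, h5⟩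
  exact ⟨α, β, h1, h2, h3, h4, (EReal.coe_le_coe_iff.2 h).trans h5⟩

/-- The topology of the Gromov boundary: a set is open if with each of its points `p` it contains
some `V(p, r)`. -/
instance gromovBoundaryTopology (S : Set G) : TopologicalSpace (GromovBoundary S) where
  IsOpen U := ∀ p ∈ U, ∃ r : ℝ, boundaryNhd S p r ⊆ U
  isOpen_univ := fun _ _ => ⟨0, Set.subset_univ _⟩
  isOpen_inter := fun U V hU hV p hp => by
    obtain ⟨r, hr⟩ := hU p hp.1
    obtain ⟨r', hr'⟩ := hV p hp.2
    exact ⟨max r r', Set.subset_inter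
      ((boundaryNhd_anti S p (le_max_left r r')).trans hr)
      ((boundaryNhd_anti S p (le_max_right r r')).trans hr')⟩
  isOpen_sUnion := fun 𝒰 h𝒰 p hp => by
    obtain ⟨U, hU, hpU⟩ := hp
    obtain ⟨r, hr⟩ := h𝒰 U hU p hpU
    exact ⟨r, hr.trans (Set.subset_sUnion_of_mem hU)⟩

end HyperbolicGroup

/-! Every boundary point is the end of a ray from $1$, and two such rays have the same end iff they
stay within $D$ of each other at all times (`ray_fellow`). Cut rays into steps of length $k = 3D+1$
and record, at each point $x$ on the sphere of radius $nk$, the next step and the patch of that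
sphere within $D$ of $x$. As with Cannon's cone types, a patch together with a geodesic step $h$
decides the patch at $xh$ and the geodesic continuations from there (`length_transfer`,
`extension_transfer`, `patch_transfer`). So rays are coded by words subject only to conditions on
the first letter and on consecutive letters.

Bare patches do not reveal the relative position of two nearby rays. The spheres are therefore
coloured from a finite palette, injectively at scale $2D$: the colour of $y$ found in the patch of
$x$ then determines $x^{-1}y$, and nearness becomes a condition on pairs of letters
(`near_iff_isNearPair`). The colouring must itself obey the local rule. A point inherits the colour
of an ancestor $k$ levels below together with the way down, and this larger colour is compressed to
the fixed palette by evaluating polynomials over a finite field (`exists_isSeparating`). All choices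
are `Classical.epsilon` of sets that patches and steps determine, so equal data lead to equal
choices, with or without torsion.

The coding map is a continuous surjection from a compact space to a Hausdorff one, hence a quotient
map. -/

/-! ### Thin metrics and transfer of lengths between similar points -/

section WordMetric

variable {G : Type*} [Group G]

/-- A left-invariant integral path metric with finite balls on a group, satisfying Gromov's
four-point condition with base point `1` and constant `D / 4`. -/
structure IsThinMetric (d : G → G → ℕ) (D : ℕ) : Prop where
  self : ∀ x, d x x = 0
  comm : ∀ x y, d x y = d y x
  tri : ∀ x y z, d x z ≤ d x y + d y z
  eq_of_zero : ∀ x y, d x y = 0 → x = y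
  mul_left : ∀ g x y, d (g * x) (g * y) = d x y
  geodesic : ∀ x y, ∃ γ : ℕ → G, γ 0 = x ∧ γ (d x y) = y ∧ ∀ i, d (γ i) (γ (i + 1)) ≤ 1
  finite_ball : ∀ n, {g | d 1 g ≤ n}.Finite
  thin : ∀ x y z, 2 * (d x y + d 1 z) ≤ 2 * max (d 1 x + d z y) (d 1 y + d x z) + D

namespace IsThinMetric

variable {d : G → G → ℕ} {D : ℕ} (hd : IsThinMetric d D)
include hd

theorem dist_mul (x g : G) : d x (x * g) = d 1 g := by
  simpa using hd.mul_left x 1 g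

theorem dist_eq_length (x y : G) : d x y = d 1 (x⁻¹ * y) := by
  rw [← hd.mul_left x⁻¹ x y, inv_mul_cancel]

theorem dist_path_le {γ : ℕ → G} (h : ∀ i, d (γ i) (γ (i + 1)) ≤ 1) (i j : ℕ) :
    d (γ i) (γ (i + j)) ≤ j := by
  induction j with
  | zero => simp [hd.self]
  | succ j ih =>
    have := hd.tri (γ i) (γ (i + j)) (γ (i + (j + 1)))
    have := h (i + j)
    simp only [← add_assoc] at *
    omega

theorem exists_between (x y : G) {n : ℕ} (hn : n ≤ d x y) :
    ∃ z, d x z = n ∧ d z y = d x y - n := by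
  obtain ⟨γ, h0, h1, h2⟩ := hd.geodesic x y
  have e1 := hd.dist_path_le h2 0 n
  have e2 := hd.dist_path_le h2 n (d x y - n)
  rw [zero_add, h0] at e1
  rw [Nat.add_sub_cancel' hn, h1] at e2
  have := hd.tri x (γ n) y
  exact ⟨γ n, by omega, by omega⟩

/-- Two uses of the four-point condition, each costing $D/2$: the first bounds `d x y'` by `d y y'`,
the second then bounds `d x y`. -/
theorem fellow {x y x' y' : G} {n : ℕ} (hx : d 1 x = n) (hy : d 1 y = n)
    (hx' : d 1 x' = n + d x x') (hy' : d 1 y' = n + d y y')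
    (h : 2 * n + d x' y' ≤ d 1 x' + d 1 y') : d x y ≤ D := by
  have h1 := hd.thin x y' x'
  have h2 := hd.thin x y y'
  have := hd.comm y y'
  omega

/-- A geodesic from $1$ to $xhg$ crosses the sphere through $x$ at a point $y$, which `fellow` puts
within $D$ of $x$ since $|g| \le |h|$. By `hP`, translating $y$ by $x_0x^{-1}$ gives a point on the
sphere through $x_0$, from which $x_0hg$ is reached at the same cost. -/
theorem length_transfer_le {x x₀ h g : G}
    (hP : ∀ u, d 1 u ≤ D → d 1 (x * u) = d 1 x → d 1 (x₀ * u) = d 1 x₀)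
    (hh : d 1 (x * h) = d 1 x + d 1 h) (hg : d 1 g ≤ d 1 h) :
    d 1 (x₀ * h * g) + d 1 x ≤ d 1 x₀ + d 1 (x * h * g) := by
  have e1 := hd.dist_mul (x * h) g
  have e2 := hd.tri 1 (x * h * g) (x * h)
  rw [hd.comm (x * h * g) (x * h)] at e2
  obtain ⟨y, hy1, hy2⟩ := hd.exists_between 1 (x * h * g) (n := d 1 x) (by omega)
  have hxy : d x y ≤ D := by
    refine hd.fellow (x' := x * h) (y' := x * h * g) rfl hy1 ?_ ?_ ?_
    · rw [hd.dist_mul]; exact hh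
    · omega
    · omega
  have h3 := hP (x⁻¹ * y) (by rwa [← hd.dist_eq_length]) (by simpa using hy1)
  have h4 := hd.tri 1 (x₀ * (x⁻¹ * y)) (x₀ * h * g)
  have h5 : d (x₀ * (x⁻¹ * y)) (x₀ * h * g) = d y (x * h * g) := by
    rw [← hd.mul_left (x * x₀⁻¹)]
    congr 1 <;> group
  omega

theorem length_transfer {x x₀ h g : G}
    (hP : ∀ u, d 1 u ≤ D → (d 1 (x * u) = d 1 x ↔ d 1 (x₀ * u) = d 1 x₀))
    (hh : d 1 (x * h) = d 1 x + d 1 h) (hh₀ : d 1 (x₀ * h) = d 1 x₀ + d 1 h)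
    (hg : d 1 g ≤ d 1 h) :
    d 1 (x₀ * h * g) + d 1 x = d 1 x₀ + d 1 (x * h * g) := by
  have h1 := hd.length_transfer_le (fun u hu => (hP u hu).1) hh hg
  have h2 := hd.length_transfer_le (fun u hu => (hP u hu).2) hh₀ hg
  omega

/-- Induction along a geodesic to $u = zs$ with $|s| = 1$: `length_transfer` applies with $hz$ for
$h$ and $s$ for $g$, which is where $|h| \ge 1$ enters. -/
theorem extension_transfer {x x₀ h u : G}
    (hP : ∀ u, d 1 u ≤ D → (d 1 (x * u) = d 1 x ↔ d 1 (x₀ * u) = d 1 x₀))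
    (hh : d 1 (x * h) = d 1 x + d 1 h) (hh₀ : d 1 (x₀ * h) = d 1 x₀ + d 1 h)
    (h1 : 1 ≤ d 1 h) (hu : d 1 (x * h * u) = d 1 x + d 1 h + d 1 u) :
    d 1 (x₀ * h * u) = d 1 x₀ + d 1 h + d 1 u := by
  obtain ⟨n, hn⟩ : ∃ n, d 1 u = n := ⟨_, rfl⟩
  induction n generalizing u with
  | zero =>
    obtain rfl := hd.eq_of_zero _ _ hn
    simpa [hd.self] using hh₀
  | succ n ih =>
    obtain ⟨z, hz1, hz2⟩ := hd.exists_between 1 u (n := n) (by omega)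
    have hs : d 1 (z⁻¹ * u) = 1 := by rw [← hd.dist_eq_length]; omega
    have e1 : d (x * h * z) (x * h * u) = d z u := hd.mul_left _ _ _
    have e2 := hd.tri 1 (x * h * z) (x * h * u)
    have e3 := hd.tri 1 (x * h) (x * h * z)
    rw [hd.dist_mul] at e3
    have hz := ih (u := z) (by omega) hz1
    have e4 := hd.tri 1 h (h * z)
    rw [hd.dist_mul] at e4
    have e5 := hd.tri 1 x (x * (h * z))
    rw [hd.dist_mul] at e5
    simp only [mul_assoc] at *
    have e6 := hd.length_transfer (g := z⁻¹ * u) (h := h * z) hP (by omega) (by omega) (by omega)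
    simp only [mul_assoc, mul_inv_cancel_left] at e6
    omega

end IsThinMetric

end WordMetric

/-! ### Locally determined colourings of spheres -/

section Coloring

variable {G : Type*} [Group G] {T V : Type} [Inhabited T] [Inhabited V]

/-- A vector of length `k` leading from `z` to the sphere of radius `n * k`, chosen in terms of
the set of all such vectors only. -/
noncomputable def stepDown (d : G → G → ℕ) (k n : ℕ) (z : G) : G :=
  Classical.epsilon fun w => w ∈ {w | d 1 w = k ∧ d 1 (z * w) = n * k}

/-- The colour of the ancestor of `z` on the sphere of radius `n * k`, and the way down to it. -/
noncomputable def rawColor (d : G → G → ℕ) (k n : ℕ) (c : G → T × V) (z : G) : (T × V) × G :=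
  (c (z * stepDown d k n z), stepDown d k n z)

/-- The parameters `t` for which `f t` separates the raw colour of `z` from those of the points
near `z` on the sphere of radius `(n + 1) * k`. -/
def goodParams (d : G → G → ℕ) (D k : ℕ) (f : T → (T × V) × G → V) (n : ℕ) (c : G → T × V)
    (z : G) : Set T :=
  {t | ∀ u, d 1 u ≤ 2 * D → d 1 (z * u) = (n + 1) * k → u ≠ 1 →
    f t (rawColor d k n c z) ≠ f t (rawColor d k n c (z * u))}

/-- One step of colour reduction. -/
noncomputable def recolor (d : G → G → ℕ) (D k : ℕ) (f : T → (T × V) × G → V) (n : ℕ)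
    (c : G → T × V) (z : G) : T × V :=
  (Classical.epsilon fun t => t ∈ goodParams d D k f n c z,
    f (Classical.epsilon fun t => t ∈ goodParams d D k f n c z) (rawColor d k n c z))

/-- A colouring of the sphere of radius `n * k`. -/
noncomputable def sphereColor (d : G → G → ℕ) (D k : ℕ) (f : T → (T × V) × G → V) :
    ℕ → G → T × V
  | 0 => fun _ => default
  | n + 1 => recolor d D k f n (sphereColor d D k f n)

open Classical in
/-- The coloured sphere of radius `n * k` near `x`, seen from `x`. -/
noncomputable def patch (d : G → G → ℕ) (D k : ℕ) (f : T → (T × V) × G → V) (n : ℕ) (x : G) :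
    G → Option (T × V) := fun g =>
  if d 1 g ≤ D ∧ d 1 (x * g) = n * k then some (sphereColor d D k f n (x * g)) else none

/-- The family `f` of maps separates each raw colour from `N` others. -/
def IsSeparating (d : G → G → ℕ) (k N : ℕ) (f : T → (T × V) × G → V) : Prop :=
  ∀ (r : (T × V) × G) (R : Finset ((T × V) × G)), d 1 r.2 = k → (∀ r' ∈ R, d 1 r'.2 = k) →
    r ∉ R → R.card ≤ N → ∃ t, ∀ r' ∈ R, f t r ≠ f t r'

variable {d : G → G → ℕ} {D k : ℕ} {f : T → (T × V) × G → V}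

theorem patch_eq_some {n : ℕ} {x g : G} {c : T × V} :
    patch d D k f n x g = some c ↔
      (d 1 g ≤ D ∧ d 1 (x * g) = n * k) ∧ sphereColor d D k f n (x * g) = c := by
  classical
  unfold patch
  split_ifs with h <;> simp [h]

theorem patch_eq_iff_level {n m : ℕ} {x x₀ : G} (h : patch d D k f n x = patch d D k f m x₀)
    {g : G} (hg : d 1 g ≤ D) : d 1 (x * g) = n * k ↔ d 1 (x₀ * g) = m * k := by
  have h1 := congrFun h g
  unfold patch at h1
  split_ifs at h1 with h2 h3 h3 <;> tauto

theorem patch_eq_color {n m : ℕ} {x x₀ : G} (h : patch d D k f n x = patch d D k f m x₀)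
    {g : G} (hg : d 1 g ≤ D) (hxg : d 1 (x * g) = n * k) :
    sphereColor d D k f n (x * g) = sphereColor d D k f m (x₀ * g) := by
  have h1 := congrFun h g
  rw [(patch_eq_some).2 ⟨⟨hg, hxg⟩, rfl⟩, eq_comm, patch_eq_some] at h1
  exact h1.2.symm

namespace IsThinMetric
variable (hd : IsThinMetric d D)
include hd

theorem stepDown_spec {n : ℕ} {z : G} (hz : d 1 z = (n + 1) * k) :
    d 1 (stepDown d k n z) = k ∧ d 1 (z * stepDown d k n z) = n * k := by
  apply Classical.epsilon_spec (p := fun w => w ∈ {w | d 1 w = k ∧ d 1 (z * w) = n * k})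
  obtain ⟨y, h1, h2⟩ := hd.exists_between 1 z (n := n * k) (by rw [hz]; gcongr; omega)
  refine ⟨z⁻¹ * y, ?_, by simpa using h1⟩
  rw [← hd.dist_eq_length, hd.comm, h2, hz, add_mul, one_mul, Nat.add_sub_cancel_left]

theorem dist_stepDown_le {n : ℕ} {z z' w w' : G} (hz : d 1 z = (n + 1) * k)
    (hz' : d 1 z' = (n + 1) * k) (h : d z z' ≤ 2 * k) (hw : d 1 w = k) (hw' : d 1 w' = k)
    (hzw : d 1 (z * w) = n * k) (hzw' : d 1 (z' * w') = n * k) : d (z * w) (z' * w') ≤ D := by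
  rw [add_mul, one_mul] at hz hz'
  refine hd.fellow hzw hzw' (x' := z) (y' := z') ?_ ?_ ?_
  · rw [hd.comm (z * w), hd.dist_mul, hw, hz]
  · rw [hd.comm (z' * w'), hd.dist_mul, hw', hz']
  · omega

/-- Close points with equal raw colours descend by the same vector to close ancestors of equal
colour; these coincide by induction, hence so do the points. A good parameter therefore exists at
each point, and neighbours sharing it receive different values. -/
theorem sphereColor_proper (hk : 3 * D ≤ k) {N : ℕ}
    (hN : ∀ s : Finset G, (∀ u ∈ s, d 1 u ≤ 2 * D) → s.card ≤ N)
    (hf : IsSeparating d k N f) (n : ℕ) {x y : G}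
    (hx : d 1 x = n * k) (hy : d 1 y = n * k) (hxy : d x y ≤ 2 * D)
    (hc : sphereColor d D k f n x = sphereColor d D k f n y) : x = y := by
  classical
  induction n generalizing x y with
  | zero =>
    rw [zero_mul] at hx hy
    rw [← hd.eq_of_zero _ _ hx, ← hd.eq_of_zero _ _ hy]
  | succ n ih =>
    set c := sphereColor d D k f n with hcdef
    have hraw : ∀ z z', d 1 z = (n + 1) * k → d 1 z' = (n + 1) * k → d z z' ≤ 2 * D →
        rawColor d k n c z = rawColor d k n c z' → z = z' := by
      intro z z' hz hz' hzz' he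
      obtain ⟨h1, h2⟩ := Prod.ext_iff.1 he
      obtain ⟨s1, s2⟩ := hd.stepDown_spec hz
      obtain ⟨s1', s2'⟩ := hd.stepDown_spec hz'
      have := hd.dist_stepDown_le hz hz' (by omega) s1 s1' s2 s2'
      have h3 := ih s2 s2' (by omega) h1
      simp only [rawColor] at h2
      rw [h2] at h3
      exact mul_right_cancel h3
    have hne : ∀ z, d 1 z = (n + 1) * k → ∃ t, t ∈ goodParams d D k f n c z := by
      intro z hz
      have hfin : {u | d 1 u ≤ 2 * D ∧ d 1 (z * u) = (n + 1) * k ∧ u ≠ 1}.Finite :=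
        (hd.finite_ball (2 * D)).subset fun u hu => hu.1
      obtain ⟨t, ht⟩ := hf (rawColor d k n c z)
        (hfin.toFinset.image fun u => rawColor d k n c (z * u)) (hd.stepDown_spec hz).1
        (by
          simp only [Finset.mem_image, Set.Finite.mem_toFinset]
          rintro _ ⟨u, hu, rfl⟩
          exact (hd.stepDown_spec hu.2.1).1)
        (by
          simp only [Finset.mem_image, Set.Finite.mem_toFinset]
          rintro ⟨u, ⟨hu1, hu2, hu3⟩, he⟩
          have := hraw _ _ hz hu2 (by rwa [hd.dist_mul]) he.symm
          exact hu3 (by simpa using this.symm))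
        (Finset.card_image_le.trans (hN _ fun u hu => by
          rw [Set.Finite.mem_toFinset] at hu; exact hu.1))
      refine ⟨t, fun u h1 h2 h3 => ht _ ?_⟩
      exact Finset.mem_image_of_mem _ (hfin.mem_toFinset.2 ⟨h1, h2, h3⟩)
    by_contra hxy'
    obtain ⟨h1, h2⟩ := Prod.ext_iff.1 hc
    simp only [sphereColor, recolor, ← hcdef] at h1 h2
    have h3 := Classical.epsilon_spec (hne x hx) (x⁻¹ * y)
      (by rwa [← hd.dist_eq_length]) (by simpa using hy)
      (fun h => hxy' (inv_mul_eq_one.1 h))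
    rw [mul_inv_cancel_left] at h3
    rw [← h1] at h2
    exact h3 h2

/-- New colours within $D$ of $xh$ depend on raw colours up to $2D$ further away, so levels and raw
colours are compared up to $3D \le k = |h|$. -/
theorem patch_transfer (hk : 3 * D ≤ k) {n m : ℕ} {x x₀ h : G}
    (hx : d 1 x = n * k) (hx₀ : d 1 x₀ = m * k)
    (hP : patch d D k f n x = patch d D k f m x₀) (hh : d 1 h = k)
    (hxh : d 1 (x * h) = (n + 1) * k) (hxh₀ : d 1 (x₀ * h) = (m + 1) * k) :
    patch d D k f (n + 1) (x * h) = patch d D k f (m + 1) (x₀ * h) := by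
  have hlev : ∀ g, d 1 g ≤ 3 * D →
      (d 1 (x * h * g) = (n + 1) * k ↔ d 1 (x₀ * h * g) = (m + 1) * k) := by
    intro g hg
    have := hd.length_transfer (x := x) (x₀ := x₀) (h := h) (g := g)
      (fun u hu => by rw [hx, hx₀]; exact patch_eq_iff_level hP hu)
      (by rw [hxh, hx, hh]; ring) (by rw [hxh₀, hx₀, hh]; ring) (by omega)
    rw [hx, hx₀] at this
    rw [add_mul, add_mul]
    omega
  -- Since $h^{-1}$ is one descent from $yh$, every descent from a point within $3D$ of $yh$ ends
  -- within $D$ of $y$, inside the old patch.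
  have hnear : ∀ (l : ℕ) (y g w : G), d 1 y = l * k → d 1 (y * h) = (l + 1) * k →
      d 1 g ≤ 3 * D → d 1 (y * h * g) = (l + 1) * k → d 1 w = k →
      d 1 (y * h * g * w) = l * k → d 1 (h * g * w) ≤ D := by
    intro l y g w hy hyh hg hyg hw hyw
    have := hd.dist_stepDown_le (z := y * h) (z' := y * h * g) (w := h⁻¹) (w' := w) hyh hyg
      (by rw [hd.dist_mul]; omega) (by rw [← hh, hd.comm, ← hd.mul_left h]; simp) hw
      (by simpa using hy) hyw
    rw [mul_inv_cancel_right, hd.dist_eq_length] at this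
    convert this using 2
    group
  have hraw : ∀ g, d 1 g ≤ 3 * D → d 1 (x * h * g) = (n + 1) * k →
      rawColor d k n (sphereColor d D k f n) (x * h * g) =
        rawColor d k m (sphereColor d D k f m) (x₀ * h * g) := by
    intro g hg hxg
    have hxg₀ := (hlev g hg).1 hxg
    -- Equality of the sets of admissible descents suffices, as `Classical.epsilon` depends on
    -- nothing else.
    have hstep : stepDown d k n (x * h * g) = stepDown d k m (x₀ * h * g) := by
      unfold stepDown
      congr 1
      ext w
      refine and_congr_right fun hw => ⟨fun h1 => ?_, fun h1 => ?_⟩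
      · have h2 := hnear n x g w hx hxh hg hxg hw h1
        simp only [mul_assoc] at h1 h2 ⊢
        exact (patch_eq_iff_level hP h2).1 h1
      · have h2 := hnear m x₀ g w hx₀ hxh₀ hg hxg₀ hw h1
        simp only [mul_assoc] at h1 h2 ⊢
        exact (patch_eq_iff_level hP h2).2 h1
    obtain ⟨s1, s2⟩ := hd.stepDown_spec hxg
    have h2 := hnear n x g _ hx hxh hg hxg s1 s2
    unfold rawColor
    rw [← hstep]
    refine Prod.ext ?_ rfl
    simp only [mul_assoc] at s2 h2 ⊢
    exact patch_eq_color hP h2 s2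
  have hcol : ∀ g, d 1 g ≤ D → d 1 (x * h * g) = (n + 1) * k →
      sphereColor d D k f (n + 1) (x * h * g) = sphereColor d D k f (m + 1) (x₀ * h * g) := by
    intro g hg hxg
    have hgood : goodParams d D k f n (sphereColor d D k f n) (x * h * g) =
        goodParams d D k f m (sphereColor d D k f m) (x₀ * h * g) := by
      ext t
      refine forall_congr' fun u => forall_congr' fun hu => ?_
      have hgu : d 1 (g * u) ≤ 3 * D := by
        have := hd.tri 1 g (g * u)
        rw [hd.dist_mul] at this
        omega
      have h1 := hlev _ hgu
      have h2 := hraw _ hgu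
      have h3 := hraw g (by omega) hxg
      simp only [mul_assoc] at h1 h2 h3 ⊢
      rw [← h1]
      refine forall_congr' fun h4 => ?_
      rw [h2 h4, h3]
    simp only [sphereColor, recolor]
    rw [hgood, hraw g (by omega) hxg]
  ext g c
  rw [patch_eq_some, patch_eq_some]
  constructor
  · rintro ⟨⟨h1, h2⟩, h3⟩
    exact ⟨⟨h1, (hlev g (by omega)).1 h2⟩, by rw [← hcol g h1 h2, h3]⟩
  · rintro ⟨⟨h1, h2⟩, h3⟩
    have h2' := (hlev g (by omega)).2 h2
    exact ⟨⟨h1, h2'⟩, by rw [hcol g h1 h2', h3]⟩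

end IsThinMetric

end Coloring

/-! ### Colour reduction by polynomials over a finite field -/

section Separating

-- Raw colours become coefficients of distinct polynomials of degree at most $2$ over $\mathbb F_q$.
-- The product of at most $N$ differences has degree at most $2N < q$, so it has a non-root $t$.
open Polynomial in
theorem exists_isSeparating {G : Type*} [Group G] (d : G → G → ℕ) (k N : ℕ)
    (hfin : {g | d 1 g ≤ k}.Finite) :
    ∃ (T V : Type) (_ : Inhabited T) (_ : Inhabited V) (_ : Finite T) (_ : Finite V)
      (f : T → (T × V) × G → V), IsSeparating d k N f := by
  classical
  obtain ⟨q, hq, hqp⟩ := Nat.exists_infinite_primes (2 * N + hfin.toFinset.card + 1)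
  have : Fact q.Prime := ⟨hqp⟩
  obtain ⟨e⟩ : Nonempty (hfin.toFinset ↪ ZMod q) := by
    apply Function.Embedding.nonempty_of_card_le
    rw [Fintype.card_coe, ZMod.card]
    omega
  let i : G → ZMod q := fun g => if h : g ∈ hfin.toFinset then e ⟨g, h⟩ else 0
  have hi : ∀ g g', d 1 g = k → d 1 g' = k → i g = i g' → g = g' := by
    intro g g' hg hg' h
    have m : g ∈ hfin.toFinset := by simp [hg]
    have m' : g' ∈ hfin.toFinset := by simp [hg']
    simp only [i, dif_pos m, dif_pos m'] at h
    simpa using h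
  let P : (ZMod q × ZMod q) × G → (ZMod q)[X] := fun r =>
    C (i r.2) * X ^ 2 + C r.1.2 * X + C r.1.1
  refine ⟨ZMod q, ZMod q, inferInstance, inferInstance, inferInstance, inferInstance,
    fun t r => (P r).eval t, ?_⟩
  intro r R hr hR hrR hcard
  have hne : ∏ r' ∈ R, (P r - P r') ≠ 0 := by
    rw [Finset.prod_ne_zero_iff]
    intro r' hr' h0
    have h0 := sub_eq_zero.1 h0
    have c0 := congrArg (coeff · 0) h0
    have c1 := congrArg (coeff · 1) h0
    have c2 := congrArg (coeff · 2) h0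
    simp [P, coeff_X, coeff_C, coeff_X_pow] at c0 c1 c2
    have : r = r' := Prod.ext (Prod.ext c0 c1) (hi _ _ hr (hR _ hr') c2)
    exact hrR (this ▸ hr')
  have hdeg : (∏ r' ∈ R, (P r - P r')).natDegree < q := by
    refine (natDegree_prod_le _ _).trans_lt ?_
    refine (Finset.sum_le_card_nsmul _ _ 2 fun r' _ => ?_).trans_lt ?_
    · exact (natDegree_sub_le _ _).trans (max_le natDegree_quadratic_le natDegree_quadratic_le)
    · rw [smul_eq_mul]; omega
  obtain ⟨t, ht⟩ := exists_eval_ne_zero_of_natDegree_lt_card _ hne (by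
    rw [Cardinal.mk_fintype, ZMod.card]; exact_mod_cast hdeg)
  rw [eval_prod, Finset.prod_ne_zero_iff] at ht
  refine ⟨t, fun r' hr' h => ht r' hr' ?_⟩
  simpa [sub_eq_zero] using h

end Separating

/-! ### Words defined by transitions -/

section SubshiftOfFiniteType

theorem isSemiMarkovianSet_of_transitions {A : Type*} (P : A → Prop) (Q : A → A → Prop) :
    IsSemiMarkovianSet {a : ℕ → A | P (a 0) ∧ ∀ n, Q (a n) (a (n + 1))} := by
  refine ⟨{a | P (a 0)}, {a | Q (a 0) (a 1)},
    ⟨{0}, {b | P (b ⟨0, by simp⟩)}, rfl⟩,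
    ⟨{0, 1}, {b | Q (b ⟨0, by simp⟩) (b ⟨1, by simp⟩)}, rfl⟩, ?_⟩
  have h : ∀ (n : ℕ) (a : ℕ → A) (m : ℕ), wordShift^[n] a m = a (m + n) := by
    intro n
    induction n with
    | zero => intros; rfl
    | succ n ih =>
      intro a m
      rw [Function.iterate_succ_apply, ih, wordShift]
      rfl
  ext a
  simp [h, add_comm 1]

end SubshiftOfFiniteType

/-! ### Coding geodesics by words -/

section Coding

variable {G : Type*} [Group G] {T V : Type} {B : Type*} {L : B → (G → Option (T × V)) × G}

/-- The point reached after `n` letters of a word. -/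
def wordPos (L : B → (G → Option (T × V)) × G) (a : ℕ → B) : ℕ → G
  | 0 => 1
  | n + 1 => wordPos L a n * (L (a n)).2

theorem wordPos_congr {a b : ℕ → B} {n : ℕ} (h : ∀ i < n, a i = b i) :
    wordPos L a n = wordPos L b n := by
  induction n with
  | zero => rfl
  | succ n ih => rw [wordPos, wordPos, ih fun i hi => h i (by omega), h n (by omega)]

variable [Inhabited T] [Inhabited V] {d : G → G → ℕ} {D k : ℕ} {f : T → (T × V) × G → V}

/-- A patch is `none` off a finite ball and has finitely many possible values on it. Indexing by
`Fin N` puts the alphabet in `Type`, whatever the universe of `G`. -/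
theorem exists_letters [Finite T] [Finite V] (hfin : ∀ n, {g | d 1 g ≤ n}.Finite) :
    ∃ (N : ℕ) (L : Fin N → (G → Option (T × V)) × G),
      ∀ n x h, d 1 h = k → ∃ b, L b = (patch d D k f n x, h) := by
  have hfin1 : {p : G → Option (T × V) | ∀ g, ¬ d 1 g ≤ D → p g = none}.Finite := by
    have := (hfin D).to_subtype
    refine Set.Finite.of_injOn (t := Set.univ)
      (f := fun p (g : {g | d 1 g ≤ D}) => p g) (fun _ _ => Set.mem_univ _) ?_ Set.finite_univ
    intro p hp p' hp' h
    ext1 g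
    by_cases hg : d 1 g ≤ D
    · exact congrFun h ⟨g, hg⟩
    · rw [hp g hg, hp' g hg]
  have hfin2 := (hfin1.prod (hfin k)).to_subtype
  obtain ⟨N, ⟨e⟩⟩ := Finite.exists_equiv_fin
    ({p : G → Option (T × V) | ∀ g, ¬ d 1 g ≤ D → p g = none} ×ˢ {g | d 1 g ≤ k} : Set _)
  refine ⟨N, fun b => (e.symm b).1, fun n x h hh => ⟨e ⟨(patch d D k f n x, h), ?_, hh.le⟩, ?_⟩⟩
  · intro g hg
    simp [patch, hg]
  · simp

/-- The letters that a word may begin with. -/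
def IsInitialLetter (d : G → G → ℕ) (D k : ℕ) (f : T → (T × V) × G → V)
    (L : B → (G → Option (T × V)) × G) (b : B) : Prop :=
  (L b).1 = patch d D k f 0 1 ∧ d 1 (L b).2 = k

/-- The pairs of consecutive letters that occur along geodesic rays. -/
def IsTransition (d : G → G → ℕ) (D k : ℕ) (f : T → (T × V) × G → V)
    (L : B → (G → Option (T × V)) × G) (b b' : B) : Prop :=
  d 1 (L b).2 = k ∧ d 1 (L b').2 = k ∧ ∃ n x, d 1 x = n * k ∧ (L b).1 = patch d D k f n x ∧
    d 1 (x * (L b).2) = (n + 1) * k ∧ (L b').1 = patch d D k f (n + 1) (x * (L b).2) ∧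
    d 1 (x * (L b).2 * (L b').2) = (n + 2) * k

/-- The pairs of letters read at two nearby points from which one stays near. -/
def IsNearPair (d : G → G → ℕ) (D k : ℕ) (f : T → (T × V) × G → V)
    (L : B → (G → Option (T × V)) × G) (b c : B) : Prop :=
  ∃ n x y, d 1 x = n * k ∧ d 1 y = n * k ∧ d x y ≤ D ∧ (L b).1 = patch d D k f n x ∧
    (L c).1 = patch d D k f n y ∧ d (x * (L b).2) (y * (L c).2) ≤ D

/-- The words that code geodesic rays from the identity. -/
def codeWords (d : G → G → ℕ) (D k : ℕ) (f : T → (T × V) × G → V)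
    (L : B → (G → Option (T × V)) × G) : Set (ℕ → B) :=
  {a | IsInitialLetter d D k f L (a 0) ∧ ∀ n, IsTransition d D k f L (a n) (a (n + 1))}

namespace IsThinMetric
variable (hd : IsThinMetric d D)
include hd

/-- A transition is witnessed at some $x$, perhaps on another level, with the same patch as the
point actually reached; the transfer lemmas carry the witness over. -/
theorem wordPos_spec (hk : 3 * D + 1 ≤ k) {a : ℕ → B} (ha : a ∈ codeWords d D k f L) (n : ℕ) :
    d 1 (wordPos L a n) = n * k ∧ (L (a n)).1 = patch d D k f n (wordPos L a n) ∧
      d 1 (L (a n)).2 = k ∧ d 1 (wordPos L a (n + 1)) = (n + 1) * k := by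
  induction n with
  | zero =>
    obtain ⟨⟨h1, h2⟩, -⟩ := ha
    simp [wordPos, h1, h2, hd.self]
  | succ n ih =>
    obtain ⟨h1, h2, h3, h4⟩ := ih
    obtain ⟨-, t1, m, x, t2, t3, t4, t5, t6⟩ := ha.2 n
    set h := (L (a n)).2
    set h' := (L (a (n + 1))).2
    have hP := t3.symm.trans h2
    have e : wordPos L a (n + 1) = wordPos L a n * h := rfl
    have e' : wordPos L a (n + 1 + 1) = wordPos L a n * h * h' := rfl
    rw [e', e]
    rw [e] at h4
    refine ⟨h4, ?_, t1, ?_⟩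
    · rw [t5]
      exact hd.patch_transfer (by omega) t2 h1 hP h3 t4 h4
    · have := hd.extension_transfer (x := x) (x₀ := wordPos L a n) (h := h) (u := h')
        (fun u hu => by rw [t2, h1]; exact patch_eq_iff_level hP hu)
        (by rw [t4, t2, h3]; ring) (by rw [h4, h1, h3]; ring) (by omega)
        (by rw [t6, t2, h3, t1]; ring)
      rw [this, h1, h3, t1]; ring

theorem near_iff_isNearPair (hk : 3 * D + 1 ≤ k)
    {N : ℕ} (hN : ∀ s : Finset G, (∀ u ∈ s, d 1 u ≤ 2 * D) → s.card ≤ N)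
    (hf : IsSeparating d k N f) {a b : ℕ → B}
    (ha : a ∈ codeWords d D k f L) (hb : b ∈ codeWords d D k f L) :
    (∀ n, d (wordPos L a n) (wordPos L b n) ≤ D) ↔ ∀ n, IsNearPair d D k f L (a n) (b n) := by
  have sa := fun n => hd.wordPos_spec hk ha n
  have sb := fun n => hd.wordPos_spec hk hb n
  constructor
  · intro h n
    exact ⟨n, _, _, (sa n).1, (sb n).1, h n, (sa n).2.1, (sb n).2.1, h (n + 1)⟩
  · intro h n
    induction n with
    | zero => simp [wordPos, hd.self]
    | succ n ih =>
      obtain ⟨m, x, y, t1, t2, t3, t4, t5, t6⟩ := h n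
      obtain ⟨a1, a2, -, -⟩ := sa n
      obtain ⟨b1, b2, -, -⟩ := sb n
      set p := wordPos L a n with hp
      set q := wordPos L b n with hq
      have hPx := t4.symm.trans a2
      have hPy := t5.symm.trans b2
      have hg : d 1 (p⁻¹ * q) ≤ D := by rwa [← hd.dist_eq_length]
      have hxg : d 1 (x * (p⁻¹ * q)) = m * k :=
        (patch_eq_iff_level hPx hg).2 (by simpa using b1)
      have c1 := patch_eq_color hPx hg hxg
      have c2 := patch_eq_color hPy (g := 1) (by simp [hd.self]) (by simpa using t2)
      rw [mul_inv_cancel_left] at c1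
      rw [mul_one, mul_one] at c2
      -- Both points have the colour of $q$ and lie within $D$ of $x$, so properness at scale $2D$
      -- identifies them. Thus the witness $(x, y)$ is a translate of $(p, q)$.
      have hy : x * (p⁻¹ * q) = y := by
        refine hd.sphereColor_proper (by omega) hN hf m hxg t2 ?_ (c1.trans c2.symm)
        have := hd.tri (x * (p⁻¹ * q)) x y
        rw [hd.comm _ x, hd.dist_mul] at this
        omega
      rw [← hy, ← hd.mul_left (p * x⁻¹)] at t6
      convert t6 using 2
      · rw [wordPos, ← hp]; group
      · rw [wordPos, ← hq]; group

end IsThinMetric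

end Coding

/-! ### The word metric of a hyperbolic group is thin -/

section WordDist

variable {G : Type*} [Group G] {S : Set G}

theorem mulCayley_connected (hgen : Subgroup.closure S = ⊤) :
    (SimpleGraph.mulCayley S).Connected := by
  have hstep : ∀ x s : G, s ∈ S → (SimpleGraph.mulCayley S).Reachable x (x * s) := by
    intro x s hs
    by_cases h : x = x * s
    · rw [← h]
    · exact SimpleGraph.Adj.reachable
        ((SimpleGraph.mulCayley_adj S _ _).2 ⟨h, Or.inl (by simpa using hs)⟩)
  have h1 : ∀ g : G, (SimpleGraph.mulCayley S).Reachable 1 g := by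
    intro g
    have hg : g ∈ Subgroup.closure S := hgen ▸ Subgroup.mem_top g
    induction hg using Subgroup.closure_induction_right with
    | one => rfl
    | mul_right x _ y hy ih => exact ih.trans (hstep _ _ hy)
    | mul_inv_cancel x _ y hy ih =>
      refine ih.trans (SimpleGraph.Reachable.symm ?_)
      simpa using hstep (x * y⁻¹) y hy
  exact (SimpleGraph.connected_iff _).2 ⟨fun x y => (h1 x).symm.trans (h1 y), ⟨1⟩⟩

theorem edist_eq_wordDist (hgen : Subgroup.closure S = ⊤) (x y : G) :
    (SimpleGraph.mulCayley S).edist x y = wordDist S x y :=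
  ((mulCayley_connected hgen).preconnected x y).coe_dist_eq_edist.symm

theorem wordDist_mul_left_le (hgen : Subgroup.closure S = ⊤) (g x y : G) :
    wordDist S (g * x) (g * y) ≤ wordDist S x y := by
  obtain ⟨p, hp⟩ := (mulCayley_connected hgen).exists_walk_length_eq_dist x y
  let φ : SimpleGraph.mulCayley S →g SimpleGraph.mulCayley S :=
    ⟨fun z => g * z, fun h => SimpleGraph.mulCayley_adj_mul_iff_right.2 h⟩
  have := SimpleGraph.dist_le (p.map φ)
  rw [SimpleGraph.Walk.length_map, hp] at this
  exact this

theorem wordDist_geodesic (hgen : Subgroup.closure S = ⊤) (x y : G) :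
    ∃ γ : ℕ → G, γ 0 = x ∧ γ (wordDist S x y) = y ∧
      ∀ i, wordDist S (γ i) (γ (i + 1)) ≤ 1 := by
  obtain ⟨p, hp⟩ := (mulCayley_connected hgen).exists_walk_length_eq_dist x y
  refine ⟨p.getVert, p.getVert_zero, ?_, fun i => ?_⟩
  · rw [wordDist, ← hp, p.getVert_length]
  · by_cases hi : i < p.length
    · exact (SimpleGraph.dist_eq_one_iff_adj.2 (p.adj_getVert_succ hi)).le
    · rw [p.getVert_of_length_le (by omega), p.getVert_of_length_le (by omega)]
      simp [wordDist]

theorem wordDist_finite_ball (hfin : S.Finite) (hgen : Subgroup.closure S = ⊤) (n : ℕ) :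
    {g | wordDist S 1 g ≤ n}.Finite := by
  have hconn := mulCayley_connected hgen
  induction n with
  | zero =>
    refine (Set.finite_singleton (1 : G)).subset fun g hg => ?_
    exact ((hconn.dist_eq_zero_iff).1 (Nat.le_zero.1 hg)).symm
  | succ n ih =>
    refine (ih.union (ih.mul (hfin.union hfin.inv))).subset fun g hg => ?_
    by_cases h : wordDist S 1 g ≤ n
    · exact Or.inl h
    refine Or.inr ?_
    obtain ⟨p, hp⟩ := hconn.exists_walk_length_eq_dist 1 g
    have hg' : p.length = n + 1 := by
      rw [hp]; exact le_antisymm hg (by rw [wordDist] at h; omega)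
    have hadj := p.adj_getVert_succ (i := n) (by omega)
    rw [← hg', p.getVert_length, SimpleGraph.mulCayley_adj] at hadj
    have hlen := SimpleGraph.dist_le (p.take n)
    rw [SimpleGraph.Walk.take_length] at hlen
    refine Set.mem_mul.2 ⟨p.getVert n, hlen.trans (min_le_left _ _),
      (p.getVert n)⁻¹ * g, ?_, mul_inv_cancel_left _ _⟩
    refine hadj.2.imp id fun h => ?_
    rw [Set.mem_inv]
    simpa using h

theorem exists_isThinMetric_wordDist (hfin : S.Finite) (hgen : Subgroup.closure S = ⊤)
    (hhyp : IsHyperbolicWith S) : ∃ D, IsThinMetric (wordDist S) D := by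
  obtain ⟨δ, hδ⟩ := hhyp
  have hconn := mulCayley_connected hgen
  -- The Gromov product carries a factor $1/2$ and `thin` is stated with doubled distances, whence
  -- the factor $4$.
  obtain ⟨D, hD⟩ := exists_nat_ge (4 * δ)
  refine ⟨D, ⟨fun x => SimpleGraph.dist_self, fun x y => SimpleGraph.dist_comm,
    fun x y z => hconn.dist_triangle, fun x y h => hconn.dist_eq_zero_iff.1 h,
    fun g x y => ?_, wordDist_geodesic hgen, wordDist_finite_ball hfin hgen, fun x y z => ?_⟩⟩
  · refine le_antisymm (wordDist_mul_left_le hgen g x y) ?_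
    simpa using wordDist_mul_left_le hgen g⁻¹ (g * x) (g * y)
  · have h := hδ 1 x y z
    have hc : ∀ x : G, wordDist S x 1 = wordDist S 1 x := fun x => SimpleGraph.dist_comm
    simp only [gromovProduct, hc] at h
    rw [sub_le_iff_le_add, min_le_iff] at h
    have h' : (2 * (wordDist S x y + wordDist S 1 z) : ℝ) ≤
        2 * (wordDist S 1 x + wordDist S z y) + D ∨
        (2 * (wordDist S x y + wordDist S 1 z) : ℝ) ≤
        2 * (wordDist S 1 y + wordDist S x z) + D := by
      rcases h with h | h
      · exact Or.inr (by linarith)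
      · exact Or.inl (by linarith)
    have h'' : 2 * (wordDist S x y + wordDist S 1 z) ≤
        2 * (wordDist S 1 x + wordDist S z y) + D ∨
        2 * (wordDist S x y + wordDist S 1 z) ≤
        2 * (wordDist S 1 y + wordDist S x z) + D := by
      exact_mod_cast h'
    omega

end WordDist

/-! ### Geodesic rays -/

section Rays

variable {G : Type*} [Group G] {d : G → G → ℕ} {D : ℕ}

namespace IsThinMetric
variable (hd : IsThinMetric d D)
include hd

/-- Arriving at distance $N$ after $N$ steps leaves no slack in any earlier segment. -/
theorem isGeodesic_of_steps {γ : ℕ → G} (h0 : γ 0 = 1) (h1 : ∀ i, d (γ i) (γ (i + 1)) ≤ 1)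
    (h2 : ∀ n, ∃ N ≥ n, d 1 (γ N) = N) (m n : ℕ) : d (γ m) (γ (m + n)) = n := by
  obtain ⟨N, hN, hN'⟩ := h2 (m + n)
  obtain ⟨j, rfl⟩ := Nat.exists_eq_add_of_le hN
  have e1 := hd.dist_path_le h1 0 m
  have e2 := hd.dist_path_le h1 m n
  have e3 := hd.dist_path_le h1 (m + n) j
  rw [zero_add, h0] at e1
  have e4 := hd.tri 1 (γ m) (γ (m + n + j))
  have e5 := hd.tri (γ m) (γ (m + n)) (γ (m + n + j))
  omega

/-- The ray is the pointwise limit of geodesics from $1$ to `γ m` along a non-principal ultrafilter;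
finite balls make each coordinate eventually constant along it. -/
theorem exists_ray_from_one {γ : ℕ → G} (hγ : ∀ m n, d (γ m) (γ (m + n)) = n) :
    ∃ α : ℕ → G, α 0 = 1 ∧ (∀ m n, d (α m) (α (m + n)) = n) ∧
      ∃ C, ∀ n, d (α n) (γ n) ≤ C := by
  choose g g0 g1 g2 using fun m => hd.geodesic 1 (γ m)
  have hlen : ∀ m i, d 1 (g m i) ≤ i := fun m i => by
    have := hd.dist_path_le (g2 m) 0 i
    rwa [zero_add, g0] at this
  have hex : ∀ i, ∃ v ∈ {v | d 1 v ≤ i}, ∀ᶠ m in (hyperfilter ℕ : Filter ℕ), g m i = v := by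
    intro i
    refine (Ultrafilter.eventually_exists_mem_iff (hd.finite_ball i)).1 ?_
    exact Eventually.of_forall fun m => ⟨g m i, hlen m i, rfl⟩
  choose α _ hα using hex
  have htop : ∀ i, ∀ᶠ m in (hyperfilter ℕ : Filter ℕ), i ≤ m := fun i =>
    Nat.hyperfilter_le_atTop (eventually_ge_atTop i)
  have hγm : ∀ m, m ≤ d 1 (γ m) + d 1 (γ 0) := fun m => by
    have e1 := hγ 0 m
    rw [zero_add] at e1
    have e2 := hd.tri (γ 0) 1 (γ m)
    rw [hd.comm _ 1] at e2
    omega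
  have hgeo : ∀ m i, i + d 1 (γ 0) ≤ m → d 1 (g m i) = i ∧
      d (g m i) (γ m) = d 1 (γ m) - i := by
    intro m i hm
    have := hγm m
    have e1 := hd.dist_path_le (g2 m) i (d 1 (γ m) - i)
    rw [Nat.add_sub_cancel' (by omega), g1] at e1
    have e2 := hd.tri 1 (g m i) (γ m)
    have := hlen m i
    omega
  have h0 : α 0 = 1 := by
    obtain ⟨m, hm⟩ := (hα 0).exists
    rw [← hm, g0]
  refine ⟨α, h0, hd.isGeodesic_of_steps h0 (fun i => ?_) (fun n => ⟨n, le_rfl, ?_⟩),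
    2 * d 1 (γ 0) + d 1 (γ 0) + D, fun n => ?_⟩
  · obtain ⟨m, h1, h2⟩ := ((hα i).and (hα (i + 1))).exists
    rw [← h1, ← h2]
    exact g2 m i
  · obtain ⟨m, h1, h2⟩ := ((hα n).and (htop (n + d 1 (γ 0)))).exists
    rw [← h1]
    exact (hgeo m n h2).1
  · obtain ⟨m, h1, h2⟩ := ((hα n).and (htop (n + d 1 (γ 0)))).exists
    rw [← h1]
    obtain ⟨e1, e2⟩ := hgeo m n h2
    have e3 := hd.thin (g m n) (γ n) (γ m)
    have e4 := hγ n (m - n)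
    rw [Nat.add_sub_cancel' (by omega)] at e4
    have e5 := hγm m
    have e6 := hd.tri 1 (γ 0) (γ n)
    have e7 := hγ 0 n
    rw [zero_add] at e7
    have e8 := hd.comm (γ m) (γ n)
    omega

theorem ray_fellow {α β : ℕ → G} (hα0 : α 0 = 1) (hβ0 : β 0 = 1)
    (hα : ∀ m n, d (α m) (α (m + n)) = n) (hβ : ∀ m n, d (β m) (β (m + n)) = n)
    {n t : ℕ} (hnt : n ≤ t) (h : 2 * n + d (α t) (β t) ≤ 2 * t) : d (α n) (β n) ≤ D := by
  have ha : ∀ n, d 1 (α n) = n := fun n => by simpa [hα0] using hα 0 n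
  have hb : ∀ n, d 1 (β n) = n := fun n => by simpa [hβ0] using hβ 0 n
  obtain ⟨j, rfl⟩ := Nat.exists_eq_add_of_le hnt
  refine hd.fellow (ha n) (hb n) (x' := α (n + j)) (y' := β (n + j)) ?_ ?_ ?_
  · rw [ha, hα]
  · rw [hb, hβ]
  · rw [ha, hb]; omega

end IsThinMetric

end Rays

/-! ### Topology of the boundary -/

section Boundary

variable {G : Type*} [Group G] {S : Set G} {D : ℕ}

theorem rayEnd_eq_iff_bounded (hgen : Subgroup.closure S = ⊤) (α β : GeodesicRay S) :
    rayEnd α = rayEnd β ↔ ∃ C, ∀ n, wordDist S (α.1 n) (β.1 n) ≤ C := by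
  refine Quotient.eq.trans (exists_congr fun C => forall_congr' fun n => ?_)
  rw [edist_eq_wordDist hgen, Nat.cast_le]

theorem rayEnd_eq_iff (hgen : Subgroup.closure S = ⊤) (hd : IsThinMetric (wordDist S) D)
    {α β : GeodesicRay S} (hα : α.1 0 = 1) (hβ : β.1 0 = 1) :
    rayEnd α = rayEnd β ↔ ∀ n, wordDist S (α.1 n) (β.1 n) ≤ D := by
  rw [rayEnd_eq_iff_bounded hgen]
  refine ⟨fun ⟨C, hC⟩ n => ?_, fun h => ⟨D, h⟩⟩
  -- At time $n + C$ a distance of at most $C$ still forces a Gromov product of at least $n$.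
  have := hC (n + C)
  exact hd.ray_fellow hα hβ α.2 β.2 (t := n + C) (by omega) (by omega)

theorem exists_rayEnd_eq (hgen : Subgroup.closure S = ⊤) (hd : IsThinMetric (wordDist S) D)
    (p : GromovBoundary S) : ∃ α : GeodesicRay S, α.1 0 = 1 ∧ rayEnd α = p := by
  induction p using Quotient.inductionOn with
  | _ γ =>
    obtain ⟨α, h0, h1, h2⟩ := hd.exists_ray_from_one γ.2
    exact ⟨⟨α, h1⟩, h0, (rayEnd_eq_iff_bounded hgen ⟨α, h1⟩ γ).2 h2⟩

/-- Two boundary points are `n`-near if rays from the identity to them are at distance at most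
`D` at time `n`. -/
def BoundaryNear (S : Set G) (D n : ℕ) (p q : GromovBoundary S) : Prop :=
  ∃ α β : GeodesicRay S, α.1 0 = 1 ∧ β.1 0 = 1 ∧ rayEnd α = p ∧ rayEnd β = q ∧
    wordDist S (α.1 n) (β.1 n) ≤ D

theorem gromovProduct_rays {α β : GeodesicRay S} (hα : α.1 0 = 1) (hβ : β.1 0 = 1) (t : ℕ) :
    gromovProduct S 1 (α.1 t) (β.1 t) = t - (wordDist S (α.1 t) (β.1 t) : ℝ) / 2 := by
  have h : ∀ γ : GeodesicRay S, γ.1 0 = 1 → wordDist S (γ.1 t) 1 = t := by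
    intro γ hγ
    have := γ.2 0 t
    rw [zero_add, hγ] at this
    exact SimpleGraph.dist_comm.trans this
  rw [gromovProduct, h α hα, h β hβ]
  ring

theorem boundaryNear_of_mem (hd : IsThinMetric (wordDist S) D) {n : ℕ} {r : ℝ} (hn : n < r)
    {p q : GromovBoundary S} (h : q ∈ boundaryNhd S p r) : BoundaryNear S D n p q := by
  obtain ⟨α, β, hα, hβ, hp, hq, hr⟩ := h
  refine ⟨α, β, hα, hβ, hp, hq, ?_⟩
  have h1 : ((n : ℝ) : EReal) < liminf
      (fun t : ℕ => ((gromovProduct S 1 (α.1 t) (β.1 t) : ℝ) : EReal)) atTop :=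
    lt_of_lt_of_le (EReal.coe_lt_coe_iff.2 hn) hr
  obtain ⟨t, ht, hnt⟩ := ((eventually_lt_of_lt_liminf h1).and (eventually_ge_atTop n)).exists
  rw [EReal.coe_lt_coe_iff, gromovProduct_rays hα hβ] at ht
  refine hd.ray_fellow hα hβ α.2 β.2 hnt ?_
  have : (2 * n + wordDist S (α.1 t) (β.1 t) : ℝ) ≤ 2 * t := by linarith
  exact_mod_cast this

theorem mem_of_boundaryNear (hd : IsThinMetric (wordDist S) D) {n : ℕ} {r : ℝ}
    (hn : r + D ≤ n) {p q : GromovBoundary S} (h : BoundaryNear S D n p q) :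
    q ∈ boundaryNhd S p r := by
  obtain ⟨α, β, hα, hβ, hp, hq, hD⟩ := h
  refine ⟨α, β, hα, hβ, hp, hq, le_liminf_of_le (by isBoundedDefault) ?_⟩
  filter_upwards [eventually_ge_atTop n] with t ht
  rw [EReal.coe_le_coe_iff, gromovProduct_rays hα hβ]
  obtain ⟨j, rfl⟩ := Nat.exists_eq_add_of_le ht
  have e1 := hd.tri (α.1 (n + j)) (α.1 n) (β.1 (n + j))
  have e2 := hd.tri (α.1 n) (β.1 n) (β.1 (n + j))
  rw [hd.comm _ (α.1 n), α.2] at e1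
  rw [β.2] at e2
  have e3 : (wordDist S (α.1 (n + j)) (β.1 (n + j)) : ℝ) ≤ j + (D + j) := by
    exact_mod_cast (by omega)
  have e4 : (0 : ℝ) ≤ D := Nat.cast_nonneg _
  push_cast
  linarith

theorem BoundaryNear.symm (hd : IsThinMetric (wordDist S) D) {n : ℕ} {p q : GromovBoundary S}
    (h : BoundaryNear S D n p q) : BoundaryNear S D n q p := by
  obtain ⟨α, β, hα, hβ, hp, hq, hD⟩ := h
  exact ⟨β, α, hβ, hα, hq, hp, by rwa [hd.comm]⟩

/-- Three distances of at most $D$ add up, since the two rays to $q$ may differ; going back $3D$ in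
time restores the bound $D$. -/
theorem BoundaryNear.trans (hgen : Subgroup.closure S = ⊤) (hd : IsThinMetric (wordDist S) D)
    {n : ℕ} {p q s : GromovBoundary S} (h : BoundaryNear S D (n + 3 * D) p q)
    (h' : BoundaryNear S D (n + 3 * D) q s) : BoundaryNear S D n p s := by
  obtain ⟨α, β, hα, hβ, hp, hq, hD⟩ := h
  obtain ⟨β', γ, hβ', hγ, hq', hs, hD'⟩ := h'
  have e := (rayEnd_eq_iff hgen hd hβ hβ').1 (hq.trans hq'.symm) (n + 3 * D)
  have e1 := hd.tri (α.1 (n + 3 * D)) (β.1 (n + 3 * D)) (γ.1 (n + 3 * D))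
  have e2 := hd.tri (β.1 (n + 3 * D)) (β'.1 (n + 3 * D)) (γ.1 (n + 3 * D))
  exact ⟨α, γ, hα, hγ, hp, hs,
    hd.ray_fellow hα hγ α.2 γ.2 (t := n + 3 * D) (by omega) (by omega)⟩

theorem eq_of_forall_boundaryNear (hgen : Subgroup.closure S = ⊤)
    (hd : IsThinMetric (wordDist S) D) {p q : GromovBoundary S}
    (h : ∀ n, BoundaryNear S D n p q) : p = q := by
  obtain ⟨α, β, hα, hβ, rfl, rfl, -⟩ := h 0
  refine (rayEnd_eq_iff_bounded hgen α β).2 ⟨3 * D, fun n => ?_⟩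
  obtain ⟨α', β', hα', hβ', hp, hq, hD⟩ := h n
  have e1 := (rayEnd_eq_iff hgen hd hα hα').1 hp.symm n
  have e2 := (rayEnd_eq_iff hgen hd hβ' hβ).1 hq n
  have e3 := hd.tri (α.1 n) (α'.1 n) (β.1 n)
  have e4 := hd.tri (α'.1 n) (β'.1 n) (β.1 n)
  omega

/-- The topology does not presuppose that the basic sets are neighbourhoods. These interiors supply
the open sets that separate points. -/
theorem isOpen_boundaryNear_interior (hgen : Subgroup.closure S = ⊤)
    (hd : IsThinMetric (wordDist S) D) (n : ℕ) (p : GromovBoundary S) :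
    IsOpen {q | ∃ m, ∀ s, BoundaryNear S D m q s → BoundaryNear S D n p s} := by
  rintro q ⟨m, hm⟩
  refine ⟨(m + 3 * D : ℕ) + 1, fun s hs => ⟨m + 3 * D, fun t ht => hm t ?_⟩⟩
  exact (boundaryNear_of_mem hd (lt_add_one _) hs).trans hgen hd ht

theorem t2Space_gromovBoundary (hgen : Subgroup.closure S = ⊤)
    (hd : IsThinMetric (wordDist S) D) : T2Space (GromovBoundary S) := by
  have hrefl : ∀ n (p : GromovBoundary S), BoundaryNear S D n p p := fun n p => by
    obtain ⟨α, hα, hp⟩ := exists_rayEnd_eq hgen hd p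
    exact ⟨α, α, hα, hα, hp, hp, by simp [hd.self]⟩
  refine ⟨fun p q hpq => ?_⟩
  obtain ⟨n, hn⟩ : ∃ n, ¬ BoundaryNear S D n p q := by
    by_contra! h
    exact hpq (eq_of_forall_boundaryNear hgen hd h)
  refine ⟨_, _, isOpen_boundaryNear_interior hgen hd (n + 3 * D) p,
    isOpen_boundaryNear_interior hgen hd (n + 3 * D) q, ⟨_, fun s hs => hs⟩,
    ⟨_, fun s hs => hs⟩, Set.disjoint_left.2 ?_⟩
  rintro s ⟨m, hm⟩ ⟨m', hm'⟩
  exact hn ((hm s (hrefl _ _)).trans hgen hd ((hm' s (hrefl _ _)).symm hd))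

end Boundary

/-! ### Passing between words and rays -/

section WordRays

variable {G : Type*} [Group G] {T V : Type} {B : Type*}

/-- The path through the points reached by a word, along chosen paths `geo h` from `1` to `h`. -/
def wordRay (k : ℕ) (geo : G → ℕ → G) (L : B → (G → Option (T × V)) × G) (a : ℕ → B) (m : ℕ) : G :=
  wordPos L a (m / k) * geo (L (a (m / k))).2 (m % k)

theorem wordRay_mul {k : ℕ} {geo : G → ℕ → G} {L : B → (G → Option (T × V)) × G}
    (hk : 0 < k) (hgeo0 : ∀ g, geo g 0 = 1) (a : ℕ → B) (n : ℕ) :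
    wordRay k geo L a (n * k) = wordPos L a n := by
  rw [wordRay, Nat.mul_div_cancel _ hk, Nat.mul_mod_left, hgeo0, mul_one]

variable [Inhabited T] [Inhabited V] {d : G → G → ℕ} {D k : ℕ} {f : T → (T × V) × G → V}
  {L : B → (G → Option (T × V)) × G} {geo : G → ℕ → G}

namespace IsThinMetric
variable (hd : IsThinMetric d D)
include hd

theorem wordRay_isGeodesic (hk : 3 * D + 1 ≤ k) (hgeo0 : ∀ g, geo g 0 = 1)
    (hgeo1 : ∀ g, geo g (d 1 g) = g) (hgeo2 : ∀ g i, d (geo g i) (geo g (i + 1)) ≤ 1)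
    {a : ℕ → B} (ha : a ∈ codeWords d D k f L) (m n : ℕ) :
    d (wordRay k geo L a m) (wordRay k geo L a (m + n)) = n := by
  have spec := hd.wordPos_spec hk ha
  refine hd.isGeodesic_of_steps ?_ ?_ ?_ m n
  · simpa [wordPos] using wordRay_mul (L := L) (by omega : 0 < k) hgeo0 a 0
  · intro i
    obtain ⟨q, r, hr, rfl⟩ : ∃ q r, r < k ∧ i = r + k * q :=
      ⟨i / k, i % k, Nat.mod_lt _ (by omega), (Nat.mod_add_div i k).symm⟩
    have e1 : wordRay k geo L a (r + k * q) = wordPos L a q * geo (L (a q)).2 r := by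
      rw [wordRay, Nat.add_mul_div_left _ _ (by omega), Nat.add_mul_mod_self_left,
        Nat.div_eq_of_lt hr, Nat.mod_eq_of_lt hr, zero_add]
    have e2 : wordRay k geo L a (r + k * q + 1) = wordPos L a q * geo (L (a q)).2 (r + 1) := by
      rcases (show r + 1 ≤ k from hr).lt_or_eq with h | h
      · rw [add_right_comm, wordRay, Nat.add_mul_div_left _ _ (by omega),
          Nat.add_mul_mod_self_left, Nat.div_eq_of_lt h, Nat.mod_eq_of_lt h, zero_add]
      · have : r + k * q + 1 = (q + 1) * k := by rw [← h]; ring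
        have hlen := (spec q).2.2.1
        rw [this, wordRay_mul (by omega) hgeo0, h, ← hlen, hgeo1, wordPos]
    rw [e1, e2, hd.mul_left]
    exact hgeo2 _ _
  · intro n
    refine ⟨n * k, Nat.le_mul_of_pos_right _ (by omega), ?_⟩
    rw [wordRay_mul (by omega) hgeo0, (spec n).1]

theorem exists_codeWord
    (hL : ∀ n x h, d 1 h = k → ∃ b, L b = (patch d D k f n x, h))
    {γ : ℕ → G} (h0 : γ 0 = 1) (hγ : ∀ m n, d (γ m) (γ (m + n)) = n) :
    ∃ a ∈ codeWords d D k f L, ∀ n, wordPos L a n = γ (n * k) := by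
  have hlen : ∀ n, d 1 ((γ (n * k))⁻¹ * γ ((n + 1) * k)) = k := fun n => by
    rw [← hd.dist_eq_length, add_mul, one_mul, hγ]
  have hγ1 : ∀ n, d 1 (γ n) = n := fun n => by simpa [h0] using hγ 0 n
  choose a ha using fun n => hL n (γ (n * k)) _ (hlen n)
  refine ⟨a, ⟨⟨?_, ?_⟩, fun n => ⟨?_, ?_, n, γ (n * k), hγ1 _, ?_, ?_, ?_, ?_⟩⟩, fun n => ?_⟩
  · simp [ha, h0]
  · rw [ha]; exact hlen 0
  · rw [ha]; exact hlen n
  · rw [ha]; exact hlen (n + 1)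
  · rw [ha]
  · rw [ha, mul_inv_cancel_left, hγ1]
  · rw [ha, ha, mul_inv_cancel_left]
  · rw [ha, ha, mul_inv_cancel_left, mul_inv_cancel_left, hγ1]
  · induction n with
    | zero => simp [wordPos, h0]
    | succ n ih => rw [wordPos, ih, ha, mul_inv_cancel_left]

end IsThinMetric

end WordRays

/-! ### A criterion for semi-Markovian spaces -/

section Criterion

variable {A : Type} [TopologicalSpace A] [DiscreteTopology A]

theorem isClosed_transitions (P : A → Prop) (Q : A → A → Prop) :
    IsClosed {a : ℕ → A | P (a 0) ∧ ∀ n, Q (a n) (a (n + 1))} := by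
  have h1 : IsClosed {a : ℕ → A | P (a 0)} :=
    (isClosed_discrete {b | P b}).preimage (continuous_apply 0)
  have h2 : ∀ n, IsClosed {a : ℕ → A | Q (a n) (a (n + 1))} := fun n =>
    IsClosed.preimage (f := fun a : ℕ → A => (a n, a (n + 1)))
      ((continuous_apply n).prodMk (continuous_apply (n + 1)))
      (isClosed_discrete {p : A × A | Q p.1 p.2})
  simpa only [Set.ofPred_and, Set.ofPred_forall] using h1.inter (isClosed_iInter h2)

/-- A Hausdorff space is semi-Markovian if it is a continuous image of a set of words defined by
transitions, by a map whose kernel is defined by a condition on pairs of letters. -/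
theorem isSemiMarkovianSpace_of_coding [Finite A] {Ω : Type*} [TopologicalSpace Ω] [T2Space Ω]
    (P : A → Prop) (Q R : A → A → Prop)
    (φ : {a : ℕ → A | P (a 0) ∧ ∀ n, Q (a n) (a (n + 1))} → Ω) (hφ : Continuous φ)
    (hsurj : Function.Surjective φ) (hker : ∀ a b, φ a = φ b ↔ ∀ n, R (a.1 n) (b.1 n)) :
    IsSemiMarkovianSpace Ω := by
  refine ⟨inferInstance, A, inferInstance, inferInstance, inferInstance, _, Setoid.ker φ,
    isSemiMarkovianSet_of_transitions P Q, ?_, ?_⟩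
  -- Imposing `R` on the first letter of every transition imposes it at all positions.
  · have h := isSemiMarkovianSet_of_transitions (fun p : A × A => P p.1 ∧ P p.2)
      (fun p q => (Q p.1 q.1 ∧ Q p.2 q.2) ∧ R p.1 p.2)
    unfold IsSemiMarkovianRelation
    convert h using 1
    ext w
    constructor
    · rintro ⟨⟨a, b⟩, ⟨ha, hb, hab⟩, rfl⟩
      exact ⟨⟨ha.1, hb.1⟩, fun n => ⟨⟨ha.2 n, hb.2 n⟩, (hker ⟨a, ha⟩ ⟨b, hb⟩).1 hab n⟩⟩
    · rintro ⟨⟨h1, h2⟩, h3⟩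
      exact ⟨(fun n => (w n).1, fun n => (w n).2),
        ⟨⟨h1, fun n => (h3 n).1.1⟩, ⟨h2, fun n => (h3 n).1.2⟩,
          (hker ⟨_, _⟩ ⟨_, _⟩).2 fun n => (h3 n).2⟩, rfl⟩
  · have : CompactSpace {a : ℕ → A | P (a 0) ∧ ∀ n, Q (a n) (a (n + 1))} :=
      isCompact_iff_compactSpace.1 (isClosed_transitions P Q).isCompact
    refine ⟨Continuous.homeoOfEquivCompactToT2
      (f := Setoid.quotientKerEquivOfSurjective φ hsurj) ?_⟩
    exact continuous_quot_lift _ hφ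

end Criterion

/-! ### The boundary is semi-Markovian -/

theorem mainTheorem3 {G : Type*} [Group G] (S : Set G) (hfin : S.Finite)
    (hgen : Subgroup.closure S = ⊤) (hhyp : IsHyperbolicWith S) :
    IsSemiMarkovianSpace (GromovBoundary S) := by
  obtain ⟨D, hd⟩ := exists_isThinMetric_wordDist hfin hgen hhyp
  have := t2Space_gromovBoundary hgen hd
  obtain ⟨k, hk⟩ : ∃ k, k = 3 * D + 1 := ⟨_, rfl⟩
  have hk' : 3 * D + 1 ≤ k := hk.ge
  obtain ⟨T, V, _, _, _, _, f, hf⟩ := exists_isSeparating (wordDist S) k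
    (hd.finite_ball (2 * D)).toFinset.card (hd.finite_ball k)
  have hN : ∀ s : Finset G, (∀ u ∈ s, wordDist S 1 u ≤ 2 * D) →
      s.card ≤ (hd.finite_ball (2 * D)).toFinset.card := fun s hs =>
    Finset.card_le_card fun u hu => by simpa using hs u hu
  obtain ⟨N, L, hL⟩ := exists_letters (D := D) (k := k) (f := f) hd.finite_ball
  choose geo geo0 geo1 geo2 using fun g => hd.geodesic 1 g
  let φ : codeWords (wordDist S) D k f L → GromovBoundary S := fun a =>
    rayEnd ⟨wordRay k geo L a.1, hd.wordRay_isGeodesic hk' geo0 geo1 geo2 a.2⟩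
  have hone : ∀ a : ℕ → Fin N, wordRay k geo L a 0 = 1 := fun a => by
    simpa [wordPos] using wordRay_mul (L := L) (by omega : 0 < k) geo0 a 0
  refine isSemiMarkovianSpace_of_coding (IsInitialLetter (wordDist S) D k f L)
    (IsTransition (wordDist S) D k f L) (IsNearPair (wordDist S) D k f L) φ ?_ ?_ ?_
  -- Continuity: words sharing their first $n$ letters give rays that meet at time $nk$.
  · refine ⟨fun U hU => isOpen_iff_mem_nhds.2 fun a ha => ?_⟩
    obtain ⟨r, hr⟩ := hU (φ a) ha
    obtain ⟨n, hn⟩ := exists_nat_ge (r + D)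
    have hev : ∀ᶠ b in 𝓝 a, ∀ i ∈ Finset.range n, b.1 i = a.1 i := by
      rw [Filter.eventually_all_finset]
      intro i _
      have hc : Continuous fun b : codeWords (wordDist S) D k f L => b.1 i :=
        (continuous_apply i).comp continuous_subtype_val
      exact hc.continuousAt.eventually_mem ((isOpen_discrete {a.1 i}).mem_nhds rfl)
    filter_upwards [hev] with b hb
    refine hr (mem_of_boundaryNear hd (n := n * k) ?_
      ⟨_, _, hone a.1, hone b.1, rfl, rfl, ?_⟩)
    · refine hn.trans ?_
      exact_mod_cast Nat.le_mul_of_pos_right _ (by omega)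
    · change wordDist S (wordRay k geo L a.1 (n * k)) (wordRay k geo L b.1 (n * k)) ≤ D
      rw [wordRay_mul (by omega) geo0, wordRay_mul (by omega) geo0,
        wordPos_congr fun i hi => (hb i (Finset.mem_range.2 hi)).symm, hd.self]
      exact Nat.zero_le _
  · intro p
    obtain ⟨α, hα, rfl⟩ := exists_rayEnd_eq hgen hd p
    obtain ⟨a, ha, hpos⟩ := hd.exists_codeWord hL hα α.2
    -- The two rays meet at every multiple of $k$ and move less than $k$ each from the last one to
    -- time $n$.
    refine ⟨⟨a, ha⟩, (rayEnd_eq_iff_bounded hgen _ _).2 ⟨2 * k, fun n => ?_⟩⟩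
    have e1 := hd.wordRay_isGeodesic hk' geo0 geo1 geo2 ha (n / k * k) (n % k)
    have e2 := α.2 (n / k * k) (n % k)
    rw [Nat.div_add_mod'] at e1 e2
    rw [wordRay_mul (by omega) geo0, hpos] at e1
    have e3 := hd.tri (wordRay k geo L a n) (α.1 (n / k * k)) (α.1 n)
    rw [hd.comm _ (α.1 (n / k * k)), e1, e2] at e3
    have := Nat.mod_lt n (by omega : k > 0)
    exact e3.trans (by omega)
  · intro a b
    refine (rayEnd_eq_iff hgen hd (hone a.1) (hone b.1)).trans
      (Iff.trans ?_ (hd.near_iff_isNearPair hk' hN hf a.2 b.2))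
    constructor
    · intro h n
      have : wordDist S (wordRay k geo L a.1 (n * k)) (wordRay k geo L b.1 (n * k)) ≤ D :=
        h (n * k)
      rwa [wordRay_mul (by omega) geo0, wordRay_mul (by omega) geo0] at this
    · intro h n
      -- Nearness at multiples of $k$ extends to time $n$ by looking ahead to $t = (n+D)k$, where
      -- $2n + D \le 2t$.
      refine hd.ray_fellow (hone a.1) (hone b.1)
        (hd.wordRay_isGeodesic hk' geo0 geo1 geo2 a.2)
        (hd.wordRay_isGeodesic hk' geo0 geo1 geo2 b.2) (t := (n + D) * k) ?_ ?_
      · exact (Nat.le_add_right n D).trans (Nat.le_mul_of_pos_right _ (by omega))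
      · rw [wordRay_mul (by omega) geo0, wordRay_mul (by omega) geo0]
        have h1 := h (n + D)
        have h2 : n + D ≤ (n + D) * k := Nat.le_mul_of_pos_right _ (by omega)
        omega
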